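/- Let $M=(Act,P,\Gamma,\Delta)$ be a synchronized dynamic pushdown network: $P,\Gamma,Act$ are finite and $P,\Gamma$ are disjoint, $Act=\{\tau\}\cup Lab$, with an involution $a\mapsto\overline a$ on $Lab$, and $\Delta$ is a finite set of rules $p\gamma\xrightarrow{a}p'w$ and $p\gamma\xrightarrow{a}p_2w_2\,p_1w_1$ ($w,w_1,w_2\in\Gamma^*$). Configurations are the words $p_1v_1\cdots p_nv_n\in(P\Gamma^*)^*$, read as $n$ parallel processes. We have $c\xrightarrow{a}c'$ if $c'$ arises from $c$ by rewriting one process with a rule labelled $a\in Act$, and $c\xrightarrow{\tau}c'$ also if $c'$ arises by rewriting two different processes simultaneously with rules labelled $l$ and $\overline l$, $l\in Lab$. For a set $C$ of configurations, $pre^*_\Pi(M,C)$ is the set of pairs $(c',\pi)$, with $\pi=a_1\cdots a_n\in Act^*$, such that $c'\xrightarrow{a_1}\cdots\xrightarrow{a_n}c$ for some $c\in C$. An $M$-automaton $A$ is a finite automaton over $P\cup\Gamma$ with state set $S_C\sqcup S_S$, initial state in $S_C$, final states in $S_C$, and transitions only in $S_C\times P\times S_S$, $S_S\times\Gamma\times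 S_S$ and $S_S\times\{\varepsilon\}\times S_C$, such that for $s\in S_C$, $p\in P$ there is at most one transition $s\xrightarrow{p}s_p$, the states $s_p$ are pairwise distinct for distinct pairs $(s,p)$, and no other transition enters $s_p$. Let $A$ be an $M$-automaton, $C$ the set of configurations that it accepts. First add to $A$ a new state $s_p\in S_S$ and a transition $s\xrightarrow{p}s_p$ wherever there is none. Then $A_{pre^*}$ has the least set of $\Gamma$-transitions that contains those of $A$ and is closed under: (R1) if $p\gamma\xrightarrow{a}p'w\in\Delta$ and there is a path from $s_{p'}$ to $q\in S_S$ reading $w$, then $s_p\xrightarrow{\gamma}q$; (R2) if $p\gamma\xrightarrow{a}p_2w_2p_1w_1\in\Delta$ and there is a path $s_{p_2}\xrightarrow{w_2}s''\xrightarrow{\varepsilon}s'\xrightarrow{p_1}s'_{p_1}\xrightarrow{w_1}q\in S_S$, then $s_p\xrightarrow{\gamma}q$. Let $\Pi=2^{Act^*}$. The shuffle $w\sqcup\!\sqcup w'\in\Pi$ of two words is given by $w\sqcup\!\sqcup\varepsilon=\varepsilon\sqcup\!\sqcup w=\{w\}$ and $au\sqcup\!\sqcup bv=a(u\sqcup\!\sqcup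 bv)\cup b(au\sqcup\!\sqcup v)\cup T$, where $T=\tau(u\sqcup\!\sqcup v)$ if $a,b\in Lab$ and $b=\overline a$, and $T=\emptyset$ otherwise; it is extended to languages by unions. Order the functions $\Pi\to\Pi$ by $f\subseteq g$ iff $f(x)\subseteq g(x)$ for all $x$. Give each $\Gamma$-transition $t=(q,\gamma,q')$ of $A_{pre^*}$ a label $\lambda(q,\gamma,q'):\Pi\to\Pi$; a path $q_0\xrightarrow{\gamma_1}q_1\cdots\xrightarrow{\gamma_n}q_n$ gets the label $\lambda(q_0,\gamma_1,q_1)\circ\cdots\circ\lambda(q_{n-1},\gamma_n,q_n)$ (the identity if $n=0$). The constraints on $\lambda$ are: (Z1) $\mathrm{Id}\subseteq\lambda(t)$ for each transition $t$ of $A$; (Z2)–(Z4) for each rule $p\gamma\xrightarrow{a}p'w\in\Delta$, all $s\in S_C$, $q\in S_S$, and each path from $s_{p'}$ to $q$ reading $w$, with label $e$: $a\cdot e\subseteq\lambda(s_p,\gamma,q)$ (for $w=\gamma'$ this is $a\cdot\lambda(s_{p'},\gamma',q)\subseteq\lambda(s_p,\gamma,q)$; for $w=\varepsilon$ it is $a\cdot\mathrm{Id}\subseteq\lambda(s_p,\gamma,s_{p'})$;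 for $w=\gamma_1\gamma_2$ it is $\bigcup_{q'}a\cdot(\lambda(s_{p'},\gamma_1,q')\circ\lambda(q',\gamma_2,q))\subseteq\lambda(s_p,\gamma,q)$); (Z5) for each rule $p\gamma\xrightarrow{a}p_2w_2p_1w_1\in\Delta$, all $s\in S_C$, $q\in S_S$, and each path $s_{p_2}\xrightarrow{w_2}s''\xrightarrow{\varepsilon}s'\xrightarrow{p_1}s'_{p_1}\xrightarrow{w_1}q$ whose parts reading $w_2$ and $w_1$ have the labels $e_2$ and $e_1$: $a\cdot\bigl(e_2(\{\varepsilon\})\sqcup\!\sqcup e_1\bigr)\subseteq\lambda(s_p,\gamma,q)$, where $e_2(\{\varepsilon\})\sqcup\!\sqcup e_1$ is the function $x\mapsto e_2(\{\varepsilon\})\sqcup\!\sqcup e_1(x)$. Then the constraints have a least solution $\lambda$, and the $\Pi$-automaton $A_{pre^*_\Pi}$ obtained by labelling $A_{pre^*}$ with it accepts exactly $pre^*_\Pi(M,C)$. Here a $\Pi$-automaton accepts $(c,\pi)$, $c=p_1v_1\cdots p_nv_n$, if there is an accepting path reading $c$ whose label $e$ satisfies $\pi\in e(\{\varepsilon\})$;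 if the parts reading $v_1,\dots,v_n$ have the labels $e_1,\dots,e_n$, then $e$ is the function $y\mapsto e_1(\{\varepsilon\})\sqcup\!\sqcup\cdots\sqcup\!\sqcup e_{n-1}(\{\varepsilon\})\sqcup\!\sqcup e_n(y)$, and $e=\mathrm{Id}$ if $n=0$. -/

import Mathlib

namespace SDPN

/-- Actions: the internal action `τ` and the synchronization signals in `Lab`. -/
inductive Act (Lab : Type*) where
  | tau : Act Lab
  | sig : Lab → Act Lab

/-- Path languages: sets of words over `Act`. -/
abbrev Paths (Lab : Type*) := Set (List (Act Lab))

/-- Functions from path languages to path languages, ordered pointwise by inclusion. -/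
abbrev PathFun (Lab : Type*) := Paths Lab → Paths Lab

/-- `p γ --a--> p' w` and `p γ --a--> p₂ w₂ p₁ w₁`; in the second rule the process `p₂ w₂` is
spawned and the firing process continues as `p₁ w₁`. -/
inductive Rule (Lab P Γ : Type*) where
  | push (p : P) (γ : Γ) (a : Act Lab) (p' : P) (w : List Γ) : Rule Lab P Γ
  | spawn (p : P) (γ : Γ) (a : Act Lab) (p₂ : P) (w₂ : List Γ) (p₁ : P) (w₁ : List Γ) :
      Rule Lab P Γ

/-- A synchronized dynamic pushdown network with signals `Lab`, control states `P` and stack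
alphabet `Γ` (finite types); `bar` is the co-action map. -/
structure Network (Lab P Γ : Type*) where
  bar : Lab → Lab
  bar_bar : ∀ a, bar (bar a) = a
  rules : Finset (Rule Lab P Γ)

/-- The word `p₁ w₁ … pₙ wₙ` of `(P Γ*)*`, cut into its processes; the head of a stack word is
the top of the stack. -/
abbrev Conf (P Γ : Type*) := List (P × List Γ)

/-! ### Relaxed semantics -/

namespace Network

variable {Lab P Γ : Type*} (M : Network Lab P Γ)

/-- One process applies one rule, and becomes one process or two. -/
inductive Fires : P × List Γ → Act Lab → Conf P Γ → Prop
  | push {p γ a p' w} (x : List Γ) : Rule.push p γ a p' w ∈ M.rules →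
      Fires (p, γ :: x) a [(p', w ++ x)]
  | spawn {p γ a p₂ w₂ p₁ w₁} (x : List Γ) : Rule.spawn p γ a p₂ w₂ p₁ w₁ ∈ M.rules →
      Fires (p, γ :: x) a [(p₂, w₂), (p₁, w₁ ++ x)]

/-- The relaxed transition relation: a process performs any action on its own (an internal action
if `a = τ`, an unsynchronized one otherwise), or two processes perform a signal and its co-action
together, which is labelled `τ`. -/
inductive Step : Conf P Γ → Act Lab → Conf P Γ → Prop
  | single {t a d} (c₁ c₂ : Conf P Γ) : M.Fires t a d →
      Step (c₁ ++ [t] ++ c₂) a (c₁ ++ d ++ c₂)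
  | sync {t t' d d'} (l : Lab) (c₁ c₂ c₃ : Conf P Γ) :
      M.Fires t (.sig l) d → M.Fires t' (.sig (M.bar l)) d' →
      Step (c₁ ++ [t] ++ c₂ ++ [t'] ++ c₃) .tau (c₁ ++ d ++ c₂ ++ d' ++ c₃)

/-- Transitions of `Π`-configurations: `(c, a · π) ⟶ (c', π)` whenever `c --a--> c'`. -/
inductive PiStep : Conf P Γ × List (Act Lab) → Conf P Γ × List (Act Lab) → Prop
  | mk {c a c'} (π : List (Act Lab)) : M.Step c a c' → PiStep (c, a :: π) (c', π)

/-- `pre*_Π(M, C)`. -/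
def prePi (C : Set (Conf P Γ)) : Set (Conf P Γ × List (Act Lab)) :=
  {x | ∃ c ∈ C, Relation.ReflTransGen M.PiStep x (c, [])}

end Network

/-! ### Shuffle product and concatenation -/

/-- `b` is the co-action of `a` (`τ` has none). -/
def IsCoaction {Lab : Type*} (bar : Lab → Lab) : Act Lab → Act Lab → Prop
  | .sig a, .sig b => b = bar a
  | _, _ => False

/-- Synchronizing shuffle of two words. -/
def shuffleWord {Lab : Type*} (bar : Lab → Lab) : List (Act Lab) → List (Act Lab) → Paths Lab
  | w, [] => {w}
  | [], w => {w}
  | a :: u, b :: v =>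
      (List.cons a '' shuffleWord bar u (b :: v)) ∪ (List.cons b '' shuffleWord bar (a :: u) v) ∪
        {π | IsCoaction bar a b ∧ π ∈ List.cons .tau '' shuffleWord bar u v}
termination_by w w' => w.length + w'.length

/-- Synchronizing shuffle of two languages. -/
def shuffle {Lab : Type*} (bar : Lab → Lab) (κ₁ κ₂ : Paths Lab) : Paths Lab :=
  ⋃ π₁ ∈ κ₁, ⋃ π₂ ∈ κ₂, shuffleWord bar π₁ π₂

/-- `a · κ`. -/
def actCons {Lab : Type*} (a : Act Lab) (κ : Paths Lab) : Paths Lab := List.cons a '' κ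

/-! ### M-automata -/

/-- Reading a stack word along transitions in `S × Γ × S`. -/
inductive StackRun {Γ S : Type*} (T : S → Γ → S → Prop) : S → List Γ → S → Prop
  | nil (q : S) : StackRun T q [] q
  | cons {q γ q₁ w q'} : T q γ q₁ → StackRun T q₁ w q' → StackRun T q (γ :: w) q'

/-- An `M`-automaton with state set the disjoint union of `SC` and `SS` (finite types). Its
transitions are of the three allowed kinds; a `P`-transition from `s` on `p` leads to a state
`s_p` that is unique and dedicated to the pair `(s, p)`, and nothing else enters `s_p`. -/
structure MAutomaton (P Γ SC SS : Type*) where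
  stepP : SC → P → SS → Prop
  stepΓ : SS → Γ → SS → Prop
  stepε : SS → SC → Prop
  init : SC
  final : Set SC
  stepP_unique : ∀ s p t t', stepP s p t → stepP s p t' → t = t'
  stepP_dedicated : ∀ s p s' p' t, stepP s p t → stepP s' p' t → s = s' ∧ p = p'
  stepP_no_other_pred : ∀ s p t q γ, stepP s p t → ¬ stepΓ q γ t

namespace MAutomaton

variable {Lab P Γ SC SS : Type*}

/-- Reading a configuration: each process `p w` takes the automaton from a state in `SC` to a
state in `SC`, by a `P`-transition, transitions reading `w`, and an `ε`-transition. -/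
inductive ConfRun (A : MAutomaton P Γ SC SS) : SC → Conf P Γ → SC → Prop
  | nil (s : SC) : ConfRun A s [] s
  | cons {s p t w q s' c s''} : A.stepP s p t → StackRun A.stepΓ t w q → A.stepε q s' →
      ConfRun A s' c s'' → ConfRun A s ((p, w) :: c) s''

/-- The set of configurations accepted by `A`. -/
def language (A : MAutomaton P Γ SC SS) : Set (Conf P Γ) :=
  {c | ∃ f ∈ A.final, A.ConfRun A.init c f}

/-- `A` with a new state `s_p` for every `s` and `p` such that `A` has none (and with some
isolated states). The accepted language is the same. -/
def complete (A : MAutomaton P Γ SC SS) : MAutomaton P Γ SC (SS ⊕ SC × P) where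
  stepP s p
    | .inl t => A.stepP s p t
    | .inr x => x = (s, p) ∧ ∀ t, ¬ A.stepP s p t
  stepΓ
    | .inl q, γ, .inl q' => A.stepΓ q γ q'
    | _, _, _ => False
  stepε
    | .inl q, s => A.stepε q s
    | .inr _, _ => False
  init := A.init
  final := A.final
  stepP_unique := by
    rintro s p (t | x) (t' | x') h h'
    · exact congrArg _ (A.stepP_unique s p t t' h h')
    · exact (h'.2 t h).elim
    · exact (h.2 t' h').elim
    · exact congrArg _ (h.1.trans h'.1.symm)
  stepP_dedicated := by
    rintro s p s' p' (t | x) h h'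
    · exact A.stepP_dedicated s p s' p' t h h'
    · exact Prod.ext_iff.1 (h.1.symm.trans h'.1)
  stepP_no_other_pred := by
    rintro s p (t | x) (q | y) γ h h'
    · exact A.stepP_no_other_pred s p t q γ h h'
    all_goals exact h'

/-- A set `T` of `Γ`-transitions contains those of `A` and is closed under the saturation rules
(R₁) and (R₂). -/
structure IsSaturated (A : MAutomaton P Γ SC SS) (M : Network Lab P Γ) (T : SS → Γ → SS → Prop) :
    Prop where
  base : ∀ q γ q', A.stepΓ q γ q' → T q γ q'
  rule₁ : ∀ p γ a p' w, Rule.push p γ a p' w ∈ M.rules → ∀ s sp sp' q,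
    A.stepP s p sp → A.stepP s p' sp' → StackRun T sp' w q → T sp γ q
  rule₂ : ∀ p γ a p₂ w₂ p₁ w₁, Rule.spawn p γ a p₂ w₂ p₁ w₁ ∈ M.rules →
    ∀ s sp sp₂ q'' s' sp₁ q, A.stepP s p sp → A.stepP s p₂ sp₂ → StackRun T sp₂ w₂ q'' →
      A.stepε q'' s' → A.stepP s' p₁ sp₁ → StackRun T sp₁ w₁ q → T sp γ q

/-- The `Γ`-transitions obtained from those of `A` by saturation. -/
def satΓ (A : MAutomaton P Γ SC SS) (M : Network Lab P Γ) (q : SS) (γ : Γ) (q' : SS) : Prop :=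
  ∀ T, A.IsSaturated M T → T q γ q'

end MAutomaton

/-! ### Π-automata -/

/-- A `Π`-automaton: `Γ`-transitions carry a function on path languages. -/
structure PiAutomaton (Lab P Γ SC SS : Type*) where
  stepP : SC → P → SS → Prop
  stepΓ : SS → Γ → PathFun Lab → SS → Prop
  stepε : SS → SC → Prop
  init : SC
  final : Set SC

namespace PiAutomaton

variable {Lab P Γ SC SS : Type*}

/-- Paths along a single thread; labels are composed. -/
inductive ThreadRun (B : PiAutomaton Lab P Γ SC SS) : SS → List Γ → PathFun Lab → SS → Prop
  | nil (q : SS) : ThreadRun B q [] id q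
  | cons {q γ e₁ q₁ w e q'} : B.stepΓ q γ e₁ q₁ → ThreadRun B q₁ w e q' →
      ThreadRun B q (γ :: w) (e₁ ∘ e) q'

/-- Paths reading a nonempty configuration, up to the end of the last stack word; parallel
processes are shuffled, and the variable of all but the last one is replaced by `{ε}`. -/
inductive ConfRun (bar : Lab → Lab) (B : PiAutomaton Lab P Γ SC SS) :
    SC → Conf P Γ → PathFun Lab → SS → Prop
  | last {s p t w e q} : B.stepP s p t → B.ThreadRun t w e q → ConfRun bar B s [(p, w)] e q
  | cons {s p t w e₁ q s' c e₂ q'} : B.stepP s p t → B.ThreadRun t w e₁ q → B.stepε q s' →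
      ConfRun bar B s' c e₂ q' →
      ConfRun bar B s ((p, w) :: c) (fun y => shuffle bar (e₁ {[]}) (e₂ y)) q'

/-- The accepted `Π`-configurations `(c, π)`: there is an accepting path reading `c`, with label
`e`, such that `π ∈ e {ε}`. The empty path, with label `id`, is accepting if the initial state is
final. -/
def language (bar : Lab → Lab) (B : PiAutomaton Lab P Γ SC SS) :
    Set (Conf P Γ × List (Act Lab)) :=
  {x | (x.1 = [] ∧ B.init ∈ B.final ∧ x.2 ∈ (id : PathFun Lab) {[]}) ∨
    ∃ e q, ∃ f ∈ B.final, ConfRun bar B B.init x.1 e q ∧ B.stepε q f ∧ x.2 ∈ e {[]}}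

end PiAutomaton

/-! ### Labelling the saturated automaton -/

namespace MAutomaton

variable {Lab P Γ SC SS : Type*}

/-- The saturated automaton, with the label `lam q γ q'` on its transition from `q` to `q'`
reading `γ`. -/
def labelled (A : MAutomaton P Γ SC SS) (M : Network Lab P Γ)
    (lam : SS → Γ → SS → PathFun Lab) : PiAutomaton Lab P Γ SC SS where
  stepP := A.stepP
  stepΓ q γ e q' := A.satΓ M q γ q' ∧ e = lam q γ q'
  stepε := A.stepε
  init := A.init
  final := A.final

/-- The constraint of a rule `p γ --a--> p' w`: for each `s` and `q`, the union over all paths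
from `s_{p'}` to `q` reading `w`, with label `e`, of `a · e` is below `lam s_p γ q`. For `w` of
length one, zero and two this is (Z₂), (Z₃) and (Z₄), see the lemmas below. -/
def PushConstraint (A : MAutomaton P Γ SC SS) (M : Network Lab P Γ)
    (lam : SS → Γ → SS → PathFun Lab) (p : P) (γ : Γ) (a : Act Lab) (p' : P) (w : List Γ) : Prop :=
  ∀ s sp sp' q e, A.stepP s p sp → A.stepP s p' sp' → (A.labelled M lam).ThreadRun sp' w e q →
    (fun x => actCons a (e x)) ≤ lam sp γ q

/-- The constraint of a rule `p γ --a--> p₂ w₂ p₁ w₁`; for `w₂` and `w₁` of length one this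
is (Z₅), see the lemma below. -/
def SpawnConstraint (A : MAutomaton P Γ SC SS) (M : Network Lab P Γ)
    (lam : SS → Γ → SS → PathFun Lab) (p : P) (γ : Γ) (a : Act Lab) (p₂ : P) (w₂ : List Γ)
    (p₁ : P) (w₁ : List Γ) : Prop :=
  ∀ s sp sp₂ e₂ s'' s' sp₁ e₁ q, A.stepP s p sp →
    A.stepP s p₂ sp₂ → (A.labelled M lam).ThreadRun sp₂ w₂ e₂ s'' → A.stepε s'' s' →
    A.stepP s' p₁ sp₁ → (A.labelled M lam).ThreadRun sp₁ w₁ e₁ q →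
    (fun x => actCons a (shuffle M.bar (e₂ {[]}) (e₁ x))) ≤ lam sp γ q

/-- `lam` satisfies the labelling constraints. Triples that are not transitions of the saturated
automaton are unconstrained, so that the least solution labels them with the constant `∅`; they
are not transitions of `A.labelled M lam` either. -/
structure IsSolution (A : MAutomaton P Γ SC SS) (M : Network Lab P Γ)
    (lam : SS → Γ → SS → PathFun Lab) : Prop where
  z₁ : ∀ q γ q', A.stepΓ q γ q' → id ≤ lam q γ q'
  push : ∀ p γ a p' w, Rule.push p γ a p' w ∈ M.rules → A.PushConstraint M lam p γ a p' w
  spawn : ∀ p γ a p₂ w₂ p₁ w₁, Rule.spawn p γ a p₂ w₂ p₁ w₁ ∈ M.rules →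
    A.SpawnConstraint M lam p γ a p₂ w₂ p₁ w₁

section shortRules

variable (A : MAutomaton P Γ SC SS) (M : Network Lab P Γ) (lam : SS → Γ → SS → PathFun Lab)

theorem threadRun_nil_iff {q : SS} {e : PathFun Lab} {q' : SS} :
    (A.labelled M lam).ThreadRun q [] e q' ↔ e = id ∧ q = q' := by
  constructor
  · rintro ⟨⟩
    exact ⟨rfl, rfl⟩
  · rintro ⟨rfl, rfl⟩
    exact .nil _

theorem threadRun_cons_iff {q : SS} {γ : Γ} {w : List Γ} {e : PathFun Lab} {q' : SS} :
    (A.labelled M lam).ThreadRun q (γ :: w) e q' ↔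
      ∃ q₁ e', A.satΓ M q γ q₁ ∧ (A.labelled M lam).ThreadRun q₁ w e' q' ∧
        e = lam q γ q₁ ∘ e' := by
  constructor
  · intro h
    cases h with
    | cons h₁ h₂ => exact ⟨_, _, h₁.1, h₂, by rw [h₁.2]⟩
  · rintro ⟨q₁, e', h₁, h₂, rfl⟩
    exact .cons ⟨h₁, rfl⟩ h₂

/-- (Z₂) -/
theorem pushConstraint_one_iff (p : P) (γ : Γ) (a : Act Lab) (p' : P) (γ' : Γ) :
    A.PushConstraint M lam p γ a p' [γ'] ↔
      ∀ q s sp sp', A.stepP s p sp → A.stepP s p' sp' → A.satΓ M sp' γ' q →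
        (fun x => actCons a (lam sp' γ' q x)) ≤ lam sp γ q := by
  simp only [PushConstraint, threadRun_cons_iff, threadRun_nil_iff]
  constructor
  · intro h q s sp sp' h₁ h₂ h₃
    exact h s sp sp' q _ h₁ h₂ ⟨q, id, h₃, ⟨rfl, rfl⟩, rfl⟩
  · rintro h s sp sp' q e h₁ h₂ ⟨_, _, h₃, ⟨rfl, rfl⟩, rfl⟩
    exact h _ s sp sp' h₁ h₂ h₃

/-- (Z₃) -/
theorem pushConstraint_zero_iff (p : P) (γ : Γ) (a : Act Lab) (p' : P) :
    A.PushConstraint M lam p γ a p' [] ↔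
      ∀ s sp sp', A.stepP s p sp → A.stepP s p' sp' →
        (fun x => actCons a (id x)) ≤ lam sp γ sp' := by
  simp only [PushConstraint, threadRun_nil_iff]
  constructor
  · intro h s sp sp' h₁ h₂
    exact h s sp sp' sp' _ h₁ h₂ ⟨rfl, rfl⟩
  · rintro h s sp sp' q e h₁ h₂ ⟨rfl, rfl⟩
    exact h s sp sp' h₁ h₂

/-- (Z₄) -/
theorem pushConstraint_two_iff (p : P) (γ : Γ) (a : Act Lab) (p' : P) (γ₁ γ₂ : Γ) :
    A.PushConstraint M lam p γ a p' [γ₁, γ₂] ↔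
      ∀ q s sp sp', A.stepP s p sp → A.stepP s p' sp' →
        (fun x => ⋃ (q' : SS) (_ : A.satΓ M sp' γ₁ q' ∧ A.satΓ M q' γ₂ q),
          actCons a ((lam sp' γ₁ q' ∘ lam q' γ₂ q) x)) ≤ lam sp γ q := by
  simp only [PushConstraint, threadRun_cons_iff, threadRun_nil_iff]
  constructor
  · intro h q s sp sp' h₁ h₂ x
    exact Set.iUnion₂_subset fun q' h₃ =>
      h s sp sp' q _ h₁ h₂ ⟨q', _, h₃.1, ⟨q, id, h₃.2, ⟨rfl, rfl⟩, rfl⟩, rfl⟩ x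
  · rintro h s sp sp' q e h₁ h₂ ⟨q', _, h₃, ⟨_, _, h₄, ⟨rfl, rfl⟩, rfl⟩, rfl⟩ x
    exact (Set.subset_iUnion₂ (s := fun q' (_ : A.satΓ M sp' γ₁ q' ∧ A.satΓ M q' γ₂ _) =>
      actCons a ((lam sp' γ₁ q' ∘ lam q' γ₂ _) x)) q' ⟨h₃, h₄⟩).trans (h _ s sp sp' h₁ h₂ x)

/-- (Z₅) -/
theorem spawnConstraint_one_iff (p : P) (γ : Γ) (a : Act Lab) (p₂ : P) (γ₂ : Γ) (p₁ : P)
    (γ₁ : Γ) :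
    A.SpawnConstraint M lam p γ a p₂ [γ₂] p₁ [γ₁] ↔
      ∀ q s sp sp₂, A.stepP s p sp → A.stepP s p₂ sp₂ →
        (fun x => ⋃ (s'' : SS) (s' : SC) (sp₁ : SS) (_ : A.stepε s'' s' ∧ A.stepP s' p₁ sp₁ ∧
            A.satΓ M sp₂ γ₂ s'' ∧ A.satΓ M sp₁ γ₁ q),
          actCons a (shuffle M.bar (lam sp₂ γ₂ s'' {[]}) (lam sp₁ γ₁ q x))) ≤ lam sp γ q := by
  simp only [SpawnConstraint, threadRun_cons_iff, threadRun_nil_iff]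
  constructor
  · intro h q s sp sp₂ h₁ h₂ x
    refine Set.iUnion_subset fun s'' => Set.iUnion_subset fun s' => Set.iUnion₂_subset ?_
    rintro sp₁ ⟨h₃, h₄, h₅, h₆⟩
    exact h s sp sp₂ _ s'' s' sp₁ _ q h₁ h₂ ⟨s'', id, h₅, ⟨rfl, rfl⟩, rfl⟩ h₃ h₄
      ⟨q, id, h₆, ⟨rfl, rfl⟩, rfl⟩ x
  · rintro h s sp sp₂ e₂ s'' s' sp₁ e₁ q h₁ h₂ ⟨_, _, h₅, ⟨rfl, rfl⟩, rfl⟩ h₃ h₄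
      ⟨_, _, h₆, ⟨rfl, rfl⟩, rfl⟩ x π hπ
    refine h _ s sp sp₂ h₁ h₂ x ?_
    simp only [Set.mem_iUnion]
    exact ⟨_, s', sp₁, ⟨h₃, h₄, h₅, h₆⟩, hπ⟩

end shortRules

end MAutomaton

end SDPN

/-! The least labelling is built from finite derivations. A direct Knaster-Tarski argument is not
available: labels are arbitrary functions, and `f ∘ g` is increasing in `g` only if `f` is monotone.
`Derives` unfolds the constraints for one input word and one output word. Concatenated derivations
show that the resulting labels form a solution, and induction on derivations puts them below every
solution (`isLeast_leastLabel`). Acceptance then means one derivation per process, with the derived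
words shuffled (`mem_language_labelled_iff`).

Soundness (`Derives.sound`): a derivation from a state `s_p` unfolds into an execution ending in
processes that the unsaturated automaton reads between the same states. This works because
constraints create transitions only out of states `s_p`, which no original `Γ`-transition enters.

Completeness: a configuration of the language is accepted with the empty word, and acceptance is
closed under backward steps (`Accepts.of_step`). A fired rule puts its action at the head of the
word of its process; the shuffle then keeps it, or merges two co-actions into `τ`. -/

namespace SDPN

/-! ### Shuffle as a relation -/

/-- `π` is a synchronizing shuffle of the first two words. -/
inductive Shuffled {Lab : Type*} (bar : Lab → Lab) :
    List (Act Lab) → List (Act Lab) → List (Act Lab) → Prop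
  | nil : Shuffled bar [] [] []
  | left {u v π} (a : Act Lab) : Shuffled bar u v π → Shuffled bar (a :: u) v (a :: π)
  | right {u v π} (b : Act Lab) : Shuffled bar u v π → Shuffled bar u (b :: v) (b :: π)
  | sync {u v π} (l : Lab) : Shuffled bar u v π →
      Shuffled bar (.sig l :: u) (.sig (bar l) :: v) (.tau :: π)

namespace Shuffled

variable {Lab : Type*} {bar : Lab → Lab}

theorem nil_right : ∀ u : List (Act Lab), Shuffled bar u [] u
  | [] => .nil
  | a :: u => .left a (nil_right u)

theorem nil_left : ∀ u : List (Act Lab), Shuffled bar [] u u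
  | [] => .nil
  | a :: u => .right a (nil_left u)

theorem eq_of_nil_right {u v π : List (Act Lab)} (h : Shuffled bar u v π) (hv : v = []) :
    π = u := by
  induction h with
  | nil => rfl
  | left a _ ih => rw [ih hv]
  | right => cases hv
  | sync => cases hv

theorem eq_of_nil_left {u v π : List (Act Lab)} (h : Shuffled bar u v π) (hu : u = []) :
    π = v := by
  induction h with
  | nil => rfl
  | left => cases hu
  | right a _ ih => rw [ih hu]
  | sync => cases hu

/-- Each letter of the result stems from one or two of the three words, however they are bracketed:
a `τ` made by an inner synchronization cannot synchronize again. This lets a spawning process absorb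
the word of its child. -/
theorem assoc {u z π : List (Act Lab)} (h : Shuffled bar u z π) :
    ∀ {v w}, Shuffled bar v w z → ∃ y, Shuffled bar u v y ∧ Shuffled bar y w π := by
  induction h with
  | nil =>
    intro v w h
    cases h
    exact ⟨[], .nil, .nil⟩
  | left a _ ih =>
    intro v w h
    obtain ⟨y, h₁, h₂⟩ := ih h
    exact ⟨_, .left a h₁, .left a h₂⟩
  | right b _ ih =>
    intro v w h
    cases h with
    | left _ h =>
      obtain ⟨y, h₁, h₂⟩ := ih h
      exact ⟨_, .right _ h₁, .left _ h₂⟩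
    | right _ h =>
      obtain ⟨y, h₁, h₂⟩ := ih h
      exact ⟨_, h₁, .right _ h₂⟩
    | sync l h =>
      obtain ⟨y, h₁, h₂⟩ := ih h
      exact ⟨_, .right _ h₁, .sync l h₂⟩
  | sync l _ ih =>
    intro v w h
    cases h with
    | left _ h =>
      obtain ⟨y, h₁, h₂⟩ := ih h
      exact ⟨_, .sync l h₁, .left _ h₂⟩
    | right _ h =>
      obtain ⟨y, h₁, h₂⟩ := ih h
      exact ⟨_, .left _ h₁, .sync l h₂⟩

end Shuffled

theorem mem_shuffleWord_iff {Lab : Type*} {bar : Lab → Lab} (u v π : List (Act Lab)) :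
    π ∈ shuffleWord bar u v ↔ Shuffled bar u v π := by
  induction u, v using shuffleWord.induct generalizing π with
  | case1 u =>
    simp only [shuffleWord, Set.mem_singleton_iff]
    exact ⟨fun h => h.symm ▸ .nil_right u, fun h => h.eq_of_nil_right rfl⟩
  | case2 v hv =>
    cases v with
    | nil => exact absurd rfl hv
    | cons b v =>
      simp only [shuffleWord, Set.mem_singleton_iff]
      exact ⟨fun h => h.symm ▸ .nil_left _, fun h => h.eq_of_nil_left rfl⟩
  | case3 a u b v ih₁ ih₂ ih₃ =>
    simp only [shuffleWord, Set.mem_union, Set.mem_image, Set.mem_ofPred_eq, ih₁, ih₂, ih₃]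
    constructor
    · rintro ((⟨x, h, rfl⟩ | ⟨x, h, rfl⟩) | ⟨hab, x, h, rfl⟩)
      · exact .left a h
      · exact .right b h
      · cases a <;> cases b <;> cases hab
        exact .sync _ h
    · intro h
      cases h with
      | left _ h => exact .inl (.inl ⟨_, h, rfl⟩)
      | right _ h => exact .inl (.inr ⟨_, h, rfl⟩)
      | sync l h => exact .inr ⟨rfl, _, h, rfl⟩

theorem mem_shuffle_iff {Lab : Type*} {bar : Lab → Lab} (κ₁ κ₂ : Paths Lab)
    (π : List (Act Lab)) :
    π ∈ shuffle bar κ₁ κ₂ ↔ ∃ π₁ ∈ κ₁, ∃ π₂ ∈ κ₂, Shuffled bar π₁ π₂ π := by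
  simp only [shuffle, Set.mem_iUnion, mem_shuffleWord_iff, exists_prop]

/-! ### Executions -/

namespace Network

variable {Lab P Γ : Type*} {M : Network Lab P Γ}

/-- `c` reaches `d` by performing the actions of `π`. -/
inductive Exec (M : Network Lab P Γ) : Conf P Γ → List (Act Lab) → Conf P Γ → Prop
  | nil (c : Conf P Γ) : Exec M c [] c
  | cons {c a c' π d} : M.Step c a c' → Exec M c' π d → Exec M c (a :: π) d

theorem exec_iff {c d : Conf P Γ} {π : List (Act Lab)} :
    M.Exec c π d ↔ Relation.ReflTransGen M.PiStep (c, π) (d, []) := by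
  constructor
  · intro h
    induction h with
    | nil => exact .refl
    | cons h _ ih => exact .head (.mk _ h) ih
  · intro h
    generalize hx : (c, π) = x at h
    induction h using Relation.ReflTransGen.head_induction_on generalizing c π with
    | refl =>
      cases hx
      exact .nil _
    | head h _ ih =>
      subst hx
      cases h with
      | mk _ h => exact .cons h (ih rfl)

theorem Step.append_right {c c' : Conf P Γ} {a : Act Lab} (h : M.Step c a c') (d : Conf P Γ) :
    M.Step (c ++ d) a (c' ++ d) := by
  cases h with
  | single c₁ c₂ h => simpa using Step.single c₁ (c₂ ++ d) h
  | sync l c₁ c₂ c₃ h h' => simpa using Step.sync l c₁ c₂ (c₃ ++ d) h h'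

theorem Step.append_left {c c' : Conf P Γ} {a : Act Lab} (h : M.Step c a c') (d : Conf P Γ) :
    M.Step (d ++ c) a (d ++ c') := by
  cases h with
  | single c₁ c₂ h => simpa using Step.single (d ++ c₁) c₂ h
  | sync l c₁ c₂ c₃ h h' => simpa using Step.sync l (d ++ c₁) c₂ c₃ h h'

/-- A synchronized step carries `τ`, so a step labelled by a signal is the firing of a single
process. -/
theorem Step.sync_append {c c' d d' : Conf P Γ} {l : Lab} (h : M.Step c (.sig l) c')
    (h' : M.Step d (.sig (M.bar l)) d') : M.Step (c ++ d) .tau (c' ++ d') := by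
  cases h with
  | single c₁ c₂ h =>
    cases h' with
    | single c₃ c₄ h' => simpa using Step.sync l c₁ (c₂ ++ c₃) c₄ h h'

/-- The derivation of the shuffle serves as a schedule: it says which side moves, or that both move
together. -/
theorem Exec.append {π₁ π₂ π : List (Act Lab)} (h : Shuffled M.bar π₁ π₂ π) :
    ∀ {c₁ c₂ d₁ d₂ : Conf P Γ}, M.Exec c₁ π₁ d₁ → M.Exec c₂ π₂ d₂ →
      M.Exec (c₁ ++ c₂) π (d₁ ++ d₂) := by
  induction h with
  | nil =>
    rintro c₁ c₂ d₁ d₂ ⟨⟩ ⟨⟩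
    exact .nil _
  | left a _ ih =>
    intro c₁ c₂ d₁ d₂ h₁ h₂
    cases h₁ with
    | cons h h₁ => exact .cons (h.append_right _) (ih h₁ h₂)
  | right a _ ih =>
    intro c₁ c₂ d₁ d₂ h₁ h₂
    cases h₂ with
    | cons h h₂ => exact .cons (h.append_left _) (ih h₁ h₂)
  | sync l _ ih =>
    intro c₁ c₂ d₁ d₂ h₁ h₂
    cases h₁ with
    | cons h h₁ =>
      cases h₂ with
      | cons h' h₂ => exact .cons (h.sync_append h') (ih h₁ h₂)

end Network

/-! ### Runs of M-automata -/

theorem StackRun.mono {Γ S : Type*} {T T' : S → Γ → S → Prop}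
    (hT : ∀ q γ q', T q γ q' → T' q γ q') {q w q'} (h : StackRun T q w q') :
    StackRun T' q w q' := by
  induction h with
  | nil => exact .nil _
  | cons h _ ih => exact .cons (hT _ _ _ h) ih

theorem StackRun.append {Γ S : Type*} {T : S → Γ → S → Prop} {q w q₁ w' q'}
    (h : StackRun T q w q₁) (h' : StackRun T q₁ w' q') : StackRun T q (w ++ w') q' := by
  induction h with
  | nil => exact h'
  | cons h _ ih => exact .cons h (ih h')

/-- A state entered by no transition can only be reached by the empty path. -/
theorem StackRun.eq_of_not_entered {Γ S : Type*} {T : S → Γ → S → Prop} {q w q'}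
    (h : StackRun T q w q') (hq : ∀ q₁ γ, ¬ T q₁ γ q') : w = [] ∧ q = q' := by
  induction h with
  | nil => exact ⟨rfl, rfl⟩
  | cons h _ ih =>
    obtain ⟨rfl, rfl⟩ := ih hq
    exact (hq _ _ h).elim

namespace MAutomaton

variable {Lab P Γ SC SS : Type*}

theorem ConfRun.append {A : MAutomaton P Γ SC SS} {s c s' c' s''} (h : A.ConfRun s c s')
    (h' : A.ConfRun s' c' s'') : A.ConfRun s (c ++ c') s'' := by
  induction h with
  | nil => exact h'
  | cons h₁ h₂ h₃ _ ih => exact .cons h₁ h₂ h₃ (ih h')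

/-! #### Completion -/

/-- Completeness needs this: without `s_p`, a predecessor with control state `p` could not be read
from `s`. -/
theorem exists_complete_stepP (A : MAutomaton P Γ SC SS) (s : SC) (p : P) :
    ∃ t, A.complete.stepP s p t := by
  by_cases h : ∃ t, A.stepP s p t
  · obtain ⟨t, ht⟩ := h
    exact ⟨.inl t, ht⟩
  · exact ⟨.inr (s, p), rfl, fun t ht => h ⟨t, ht⟩⟩

theorem stackRun_complete_iff (A : MAutomaton P Γ SC SS) {t w q} :
    StackRun A.complete.stepΓ (.inl t) w (.inl q) ↔ StackRun A.stepΓ t w q := by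
  constructor
  · intro h
    generalize hx : (Sum.inl t : SS ⊕ SC × P) = x at h
    generalize hy : (Sum.inl q : SS ⊕ SC × P) = y at h
    induction h generalizing t with
    | nil =>
      cases hx
      cases hy
      exact .nil _
    | @cons q₀ γ q₁ w q' h _ ih =>
      subst hx
      cases q₁ with
      | inl q₁ => exact .cons h (ih rfl hy)
      | inr => exact h.elim
  · intro h
    induction h with
    | nil => exact .nil _
    | @cons _ _ q₁ _ _ h _ ih =>
      exact .cons (T := A.complete.stepΓ) (q₁ := .inl q₁) h ih

theorem not_stackRun_complete_inr (A : MAutomaton P Γ SC SS) {x w q}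
    (h : StackRun A.complete.stepΓ (.inr x) w (.inl q)) : False := by
  cases h with
  | cons h _ => exact h

/-- The new states have no outgoing `Γ`- or `ε`-transition, so no run through a process can use
them. -/
theorem confRun_complete_iff (A : MAutomaton P Γ SC SS) {s c s'} :
    A.complete.ConfRun s c s' ↔ A.ConfRun s c s' := by
  constructor
  · intro h
    induction h with
    | nil => exact .nil _
    | @cons s p t w q s' c s'' h₁ h₂ h₃ _ ih =>
      cases q with
      | inr => exact h₃.elim
      | inl q =>
        cases t with
        | inr => exact (A.not_stackRun_complete_inr h₂).elim
        | inl t => exact .cons h₁ (A.stackRun_complete_iff.1 h₂) h₃ ih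
  · intro h
    induction h with
    | nil => exact .nil _
    | @cons _ _ t _ q _ _ _ h₁ h₂ h₃ _ ih =>
      exact .cons (A := A.complete) (t := .inl t) (q := .inl q) h₁ (A.stackRun_complete_iff.2 h₂) h₃ ih

theorem language_complete (A : MAutomaton P Γ SC SS) : A.complete.language = A.language := by
  ext c
  simp only [language, Set.mem_ofPred_eq, confRun_complete_iff]
  rfl

/-! #### The least solution -/

variable {A : MAutomaton P Γ SC SS} {M : Network Lab P Γ}

theorem isSaturated_satΓ (A : MAutomaton P Γ SC SS) (M : Network Lab P Γ) :
    A.IsSaturated M (A.satΓ M) where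
  base q γ q' h _ hT := hT.base q γ q' h
  rule₁ p γ a p' w hr s sp sp' q h₁ h₂ h₃ T hT :=
    hT.rule₁ p γ a p' w hr s sp sp' q h₁ h₂ (h₃.mono fun _ _ _ h => h T hT)
  rule₂ p γ a p₂ w₂ p₁ w₁ hr s sp sp₂ q'' s' sp₁ q h₁ h₂ h₃ h₄ h₅ h₆ T hT :=
    hT.rule₂ p γ a p₂ w₂ p₁ w₁ hr s sp sp₂ q'' s' sp₁ q h₁ h₂ (h₃.mono fun _ _ _ h => h T hT)
      h₄ h₅ (h₆.mono fun _ _ _ h => h T hT)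

/-- `A.Derives M q w q' ρ π`: some path of the saturated automaton from `q` to `q'` reading `w`
forces `π` to be in the value of its label at any language that contains `ρ`. -/
inductive Derives (A : MAutomaton P Γ SC SS) (M : Network Lab P Γ) :
    SS → List Γ → SS → List (Act Lab) → List (Act Lab) → Prop
  | nil (q : SS) (ρ : List (Act Lab)) : Derives A M q [] q ρ ρ
  | base {q γ q₁ x q' ρ π} : A.stepΓ q γ q₁ → Derives A M q₁ x q' ρ π →
      Derives A M q (γ :: x) q' ρ π
  | push {p γ a p' w s sp sp' q₁ x q' ρ σ π} : Rule.push p γ a p' w ∈ M.rules →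
      A.stepP s p sp → A.stepP s p' sp' → Derives A M sp' w q₁ σ π →
      Derives A M q₁ x q' ρ σ → Derives A M sp (γ :: x) q' ρ (a :: π)
  | spawn {p γ a p₂ w₂ p₁ w₁ s sp sp₂ s'' s' sp₁ q₁ x q' ρ σ π₁ π₂ π} :
      Rule.spawn p γ a p₂ w₂ p₁ w₁ ∈ M.rules →
      A.stepP s p sp → A.stepP s p₂ sp₂ → Derives A M sp₂ w₂ s'' [] π₂ → A.stepε s'' s' →
      A.stepP s' p₁ sp₁ → Derives A M sp₁ w₁ q₁ σ π₁ → Shuffled M.bar π₂ π₁ π →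
      Derives A M q₁ x q' ρ σ → Derives A M sp (γ :: x) q' ρ (a :: π)

/-- As in a composition of labels, the output of the right part is the input of the left part. -/
theorem Derives.append {q w q₁ x q' ρ σ π} (h : A.Derives M q w q₁ σ π) :
    A.Derives M q₁ x q' ρ σ → A.Derives M q (w ++ x) q' ρ π := by
  induction h generalizing ρ with
  | nil => exact id
  | base h _ ih => exact fun h' => .base h (ih h')
  | push hr h₁ h₂ h₃ _ _ ih => exact fun h' => .push hr h₁ h₂ h₃ (ih h')
  | spawn hr h₁ h₂ h₃ h₄ h₅ h₆ h₇ _ _ _ ih =>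
    exact fun h' => .spawn hr h₁ h₂ h₃ h₄ h₅ h₆ h₇ (ih h')

/-- Undoes a rule application: it separates the word just pushed from the old stack below it. -/
theorem Derives.split {q y q' ρ π} (h : A.Derives M q y q' ρ π) :
    ∀ {w x}, y = w ++ x → ∃ q₁ σ, A.Derives M q w q₁ σ π ∧ A.Derives M q₁ x q' ρ σ := by
  induction h with
  | nil q ρ =>
    intro w x hy
    obtain ⟨rfl, rfl⟩ := List.append_eq_nil_iff.1 hy.symm
    exact ⟨q, ρ, .nil _ _, .nil _ _⟩
  | base h h' ih =>
    rintro (_ | ⟨γ', w⟩) x hy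
    · cases hy
      exact ⟨_, _, .nil _ _, .base h h'⟩
    · cases hy
      obtain ⟨q₁, σ, h₁, h₂⟩ := ih rfl
      exact ⟨q₁, σ, .base h h₁, h₂⟩
  | push hr h₁ h₂ h₃ h' _ ih =>
    rintro (_ | ⟨γ', w⟩) x hy
    · cases hy
      exact ⟨_, _, .nil _ _, .push hr h₁ h₂ h₃ h'⟩
    · cases hy
      obtain ⟨q₁, σ, h₄, h₅⟩ := ih rfl
      exact ⟨q₁, σ, .push hr h₁ h₂ h₃ h₄, h₅⟩
  | spawn hr h₁ h₂ h₃ h₄ h₅ h₆ h₇ h' _ _ ih =>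
    rintro (_ | ⟨γ', w⟩) x hy
    · cases hy
      exact ⟨_, _, .nil _ _, .spawn hr h₁ h₂ h₃ h₄ h₅ h₆ h₇ h'⟩
    · cases hy
      obtain ⟨q₁, σ, h₈, h₉⟩ := ih rfl
      exact ⟨q₁, σ, .spawn hr h₁ h₂ h₃ h₄ h₅ h₆ h₇ h₈, h₉⟩

theorem Derives.of_stackRun {q w q'} (h : StackRun A.stepΓ q w q') (ρ : List (Act Lab)) :
    A.Derives M q w q' ρ ρ := by
  induction h with
  | nil => exact .nil _ _
  | cons h _ ih => exact .base h ih

/-- The least labelling. -/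
def leastLabel (A : MAutomaton P Γ SC SS) (M : Network Lab P Γ) (q : SS) (γ : Γ) (q' : SS) :
    PathFun Lab :=
  fun x => {π | ∃ ρ ∈ x, A.Derives M q [γ] q' ρ π}

theorem stackRun_of_threadRun {l : SS → Γ → SS → PathFun Lab} {q w e q'}
    (h : (A.labelled M l).ThreadRun q w e q') : StackRun (A.satΓ M) q w q' := by
  induction h with
  | nil => exact .nil _
  | cons h _ ih => exact .cons h.1 ih

theorem derives_of_threadRun {q w e q'}
    (h : (A.labelled M (A.leastLabel M)).ThreadRun q w e q') {x : Paths Lab}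
    {π : List (Act Lab)} (hπ : π ∈ e x) : ∃ ρ ∈ x, A.Derives M q w q' ρ π := by
  induction h generalizing π with
  | nil => exact ⟨π, hπ, .nil _ _⟩
  | cons h _ ih =>
    obtain ⟨_, rfl⟩ := h
    obtain ⟨σ, hσ, h₁⟩ := hπ
    obtain ⟨ρ, hρ, h₂⟩ := ih hσ
    exact ⟨ρ, hρ, h₁.append h₂⟩

/-- Quantifying over every language containing `ρ` replaces monotonicity of the labels, which a
solution need not have: each constraint is applied at the value of the label of the remaining path.
-/
theorem IsSolution.threadRun_of_derives {l : SS → Γ → SS → PathFun Lab} (hl : A.IsSolution M l)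
    {q w q' ρ π} (h : A.Derives M q w q' ρ π) :
    ∃ e, (A.labelled M l).ThreadRun q w e q' ∧ ∀ x : Paths Lab, ρ ∈ x → π ∈ e x := by
  induction h with
  | nil q ρ => exact ⟨id, .nil _, fun _ h => h⟩
  | base h _ ih =>
    obtain ⟨e, he, hx⟩ := ih
    exact ⟨_, .cons ⟨(A.isSaturated_satΓ M).base _ _ _ h, rfl⟩ he,
      fun x hρ => hl.z₁ _ _ _ h _ (hx x hρ)⟩
  | push hr h₁ h₂ _ _ ih₁ ih₂ =>
    obtain ⟨e₁, he₁, hx₁⟩ := ih₁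
    obtain ⟨e₂, he₂, hx₂⟩ := ih₂
    exact ⟨_, .cons ⟨(A.isSaturated_satΓ M).rule₁ _ _ _ _ _ hr _ _ _ _ h₁ h₂
      (stackRun_of_threadRun he₁), rfl⟩ he₂,
      fun x hρ => hl.push _ _ _ _ _ hr _ _ _ _ _ h₁ h₂ he₁ _ ⟨_, hx₁ _ (hx₂ x hρ), rfl⟩⟩
  | spawn hr h₁ h₂ _ h₄ h₅ _ h₇ _ ih₁ ih₂ ih₃ =>
    obtain ⟨e₁, he₁, hx₁⟩ := ih₁
    obtain ⟨e₂, he₂, hx₂⟩ := ih₂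
    obtain ⟨e₃, he₃, hx₃⟩ := ih₃
    exact ⟨_, .cons ⟨(A.isSaturated_satΓ M).rule₂ _ _ _ _ _ _ _ hr _ _ _ _ _ _ _ h₁ h₂
      (stackRun_of_threadRun he₁) h₄ h₅ (stackRun_of_threadRun he₂), rfl⟩ he₃,
      fun x hρ => hl.spawn _ _ _ _ _ _ _ hr _ _ _ _ _ _ _ _ _ h₁ h₂ he₁ h₄ h₅ he₂ _
        ⟨_, (mem_shuffle_iff _ _ _).2 ⟨_, hx₁ _ rfl, _, hx₂ _ (hx₃ x hρ), h₇⟩, rfl⟩⟩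

theorem isSolution_leastLabel (A : MAutomaton P Γ SC SS) (M : Network Lab P Γ) :
    A.IsSolution M (A.leastLabel M) where
  z₁ _ _ _ h _ π hπ := ⟨π, hπ, .base h (.nil _ _)⟩
  push := by
    rintro p γ a p' w hr s sp sp' q e h₁ h₂ he x _ ⟨π, hπ, rfl⟩
    obtain ⟨ρ, hρ, h⟩ := derives_of_threadRun he hπ
    exact ⟨ρ, hρ, .push hr h₁ h₂ h (.nil _ _)⟩
  spawn := by
    rintro p γ a p₂ w₂ p₁ w₁ hr s sp sp₂ e₂ s'' s' sp₁ e₁ q h₁ h₂ he₂ h₄ h₅ he₁ x _ ⟨π, hπ, rfl⟩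
    obtain ⟨π₂, hπ₂, π₁, hπ₁, h⟩ := (mem_shuffle_iff _ _ _).1 hπ
    obtain ⟨_, rfl, hd₂⟩ := derives_of_threadRun he₂ hπ₂
    obtain ⟨ρ, hρ, hd₁⟩ := derives_of_threadRun he₁ hπ₁
    exact ⟨ρ, hρ, .spawn hr h₁ h₂ hd₂ h₄ h₅ hd₁ h (.nil _ _)⟩

theorem isLeast_leastLabel (A : MAutomaton P Γ SC SS) (M : Network Lab P Γ) :
    IsLeast {l | A.IsSolution M l} (A.leastLabel M) := by
  refine ⟨A.isSolution_leastLabel M, ?_⟩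
  rintro l hl q γ q' x π ⟨ρ, hρ, h⟩
  obtain ⟨e, he, hx⟩ := IsSolution.threadRun_of_derives hl h
  obtain ⟨q₁, e', _, h', rfl⟩ := (threadRun_cons_iff A M l).1 he
  obtain ⟨rfl, rfl⟩ := (threadRun_nil_iff A M l).1 h'
  exact hx x hρ

/-! #### Acceptance by the labelled automaton -/

/-- The process `t` takes the saturated automaton from `s` to `s'`, contributing the word `π`. -/
def AcceptsThread (A : MAutomaton P Γ SC SS) (M : Network Lab P Γ) (s : SC) (t : P × List Γ)
    (π : List (Act Lab)) (s' : SC) : Prop :=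
  ∃ sp q, A.stepP s t.1 sp ∧ A.Derives M sp t.2 q [] π ∧ A.stepε q s'

/-- Acceptance of `Π`-configurations from `s` to `s'`. -/
inductive Accepts (A : MAutomaton P Γ SC SS) (M : Network Lab P Γ) :
    SC → Conf P Γ → List (Act Lab) → SC → Prop
  | nil (s : SC) : Accepts A M s [] [] s
  | cons {s t π₁ s' c π₂ s'' π} : A.AcceptsThread M s t π₁ s' → Accepts A M s' c π₂ s'' →
      Shuffled M.bar π₁ π₂ π → Accepts A M s (t :: c) π s''

theorem accepts_of_confRun {s c e q f π}
    (h : PiAutomaton.ConfRun M.bar (A.labelled M (A.leastLabel M)) s c e q)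
    (hf : A.stepε q f) (hπ : π ∈ e {[]}) : A.Accepts M s c π f := by
  induction h generalizing π with
  | last h₁ h₂ =>
    obtain ⟨_, rfl, hd⟩ := derives_of_threadRun h₂ hπ
    exact .cons ⟨_, _, h₁, hd, hf⟩ (.nil _) (.nil_right _)
  | cons h₁ h₂ h₃ _ ih =>
    obtain ⟨π₁, hπ₁, π₂, hπ₂, h⟩ := (mem_shuffle_iff _ _ _).1 hπ
    obtain ⟨_, rfl, hd⟩ := derives_of_threadRun h₂ hπ₁
    exact .cons ⟨_, _, h₁, hd, h₃⟩ (ih hf hπ₂) h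

theorem Accepts.exists_confRun {s c π f} (h : A.Accepts M s c π f) (hc : c ≠ []) :
    ∃ e q, PiAutomaton.ConfRun M.bar (A.labelled M (A.leastLabel M)) s c e q ∧
      A.stepε q f ∧ π ∈ e {[]} := by
  induction h with
  | nil => exact absurd rfl hc
  | cons ht h hs ih =>
    obtain ⟨sp, q, h₁, h₂, h₃⟩ := ht
    obtain ⟨e₁, he₁, hx⟩ := IsSolution.threadRun_of_derives (A.isSolution_leastLabel M) h₂
    cases h with
    | nil =>
      -- For the last process, the shuffle is with the empty word of the empty remainder.
      obtain rfl := hs.eq_of_nil_right rfl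
      exact ⟨e₁, q, .last h₁ he₁, h₃, hx _ rfl⟩
    | cons h₄ h₅ h₆ =>
      obtain ⟨e₂, q', he₂, hq', hπ⟩ := ih (List.cons_ne_nil _ _)
      exact ⟨_, q', .cons h₁ he₁ h₃ he₂, hq',
        (mem_shuffle_iff _ _ _).2 ⟨_, hx _ rfl, _, hπ, hs⟩⟩

theorem mem_language_labelled_iff {x : Conf P Γ × List (Act Lab)} :
    x ∈ (A.labelled M (A.leastLabel M)).language M.bar ↔
      ∃ f ∈ A.final, A.Accepts M A.init x.1 x.2 f := by
  obtain ⟨c, π⟩ := x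
  constructor
  · rintro (⟨rfl, hf, hπ⟩ | ⟨e, q, f, hf, h, hq, hπ⟩)
    · obtain rfl : π = [] := hπ
      exact ⟨_, hf, .nil _⟩
    · exact ⟨f, hf, accepts_of_confRun h hq hπ⟩
  · rintro ⟨f, hf, h⟩
    by_cases hc : c = []
    · subst hc
      cases h
      exact .inl ⟨rfl, hf, rfl⟩
    · obtain ⟨e, q, h₁, h₂, h₃⟩ := h.exists_confRun hc
      exact .inr ⟨e, q, f, hf, h₁, h₂, h₃⟩

/-! #### Soundness -/

/-- Here `c` collects the finished processes and `p' w'` is the one still running. The stack `v`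
below is arbitrary, and `ρ` is what is performed afterwards. From a state that is no `s_p`, only
original transitions are possible and nothing is performed. -/
theorem Derives.sound {q w q' ρ π} (h : A.Derives M q w q' ρ π) :
    (∀ s p, A.stepP s p q → ∃ c p' w' s' sp', A.ConfRun s c s' ∧ A.stepP s' p' sp' ∧
      StackRun A.stepΓ sp' w' q' ∧ ∀ v d, M.Exec [(p', w' ++ v)] ρ d →
        M.Exec [(p, w ++ v)] π (c ++ d)) ∧
    ((∀ s p, ¬ A.stepP s p q) → ρ = π ∧ StackRun A.stepΓ q w q') := by
  induction h with
  | nil q ρ =>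
    exact ⟨fun s p h => ⟨[], p, [], s, q, .nil _, h, .nil _, fun _ _ h => h⟩,
      fun _ => ⟨rfl, .nil _⟩⟩
  | @base q γ q₁ x q' ρ π h _ ih =>
    -- An original transition ends in no `s_p`, so the rest of the path is original too.
    obtain ⟨rfl, hx⟩ := ih.2 fun s p h' => A.stepP_no_other_pred s p _ _ _ h' h
    exact ⟨fun s p h' => ⟨[], p, γ :: x, s, q, .nil _, h', .cons h hx, fun _ _ h => h⟩,
      fun _ => ⟨rfl, .cons h hx⟩⟩
  | @push p γ a p' w s sp sp' q₁ x q' ρ σ π hr h₁ h₂ _ _ ih₁ ih₂ =>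
    refine ⟨?_, fun hn => (hn _ _ h₁).elim⟩
    intro s₀ p₀ h₀
    obtain ⟨rfl, rfl⟩ := A.stepP_dedicated _ _ _ _ _ h₁ h₀
    obtain ⟨c, p'', w', s', t, hc, ht, hw, hex⟩ := ih₁.1 _ _ h₂
    have fire : ∀ v d, M.Exec [(p'', w' ++ v)] σ d → M.Exec [(p, γ :: v)] (a :: π) (c ++ d) :=
      fun v d h => .cons (by simpa using Network.Step.single [] [] (Network.Fires.push v hr))
        (hex v d h)
    -- If `q₁` is some `s_p`, the original path into it is empty: the pushed word has been used up
    -- and the process goes on popping `x`. Otherwise `x` is read unchanged.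
    by_cases hq : ∃ s p, A.stepP s p q₁
    · obtain ⟨s₁, p₁, hq⟩ := hq
      obtain ⟨rfl, rfl⟩ := hw.eq_of_not_entered fun _ _ => A.stepP_no_other_pred _ _ _ _ _ hq
      obtain ⟨c₂, p₃, w₃, s₃, t₃, hc₃, ht₃, hw₃, hex₃⟩ := ih₂.1 _ _ ht
      refine ⟨c ++ c₂, p₃, w₃, s₃, t₃, hc.append hc₃, ht₃, hw₃, fun v d h => ?_⟩
      rw [List.append_assoc]
      exact fire (x ++ v) _ (hex₃ v d h)
    · push Not at hq
      obtain ⟨rfl, hx⟩ := ih₂.2 hq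
      refine ⟨c, p'', w' ++ x, s', t, hc, ht, hw.append hx, fun v d h => ?_⟩
      exact fire (x ++ v) _ (by rwa [← List.append_assoc])
  | @spawn p γ a p₂ w₂ p₁ w₁ s sp sp₂ s'' s' sp₁ q₁ x q' ρ σ π₁ π₂ π hr h₁ h₂ _ h₄ h₅ _ h₇ _
      ih₁ ih₂ ih₃ =>
    refine ⟨?_, fun hn => (hn _ _ h₁).elim⟩
    intro s₀ p₀ h₀
    obtain ⟨rfl, rfl⟩ := A.stepP_dedicated _ _ _ _ _ h₁ h₀
    obtain ⟨c₂, p₂', w₂', s₂, t₂, hc₂, ht₂, hw₂, hex₂⟩ := ih₁.1 _ _ h₂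
    obtain ⟨c₁, p₁', w₁', s₁, t₁, hc₁, ht₁, hw₁, hex₁⟩ := ih₂.1 _ _ h₅
    have hc : A.ConfRun s (c₂ ++ [(p₂', w₂')] ++ c₁) s₁ :=
      (hc₂.append (.cons ht₂ hw₂ h₄ (.nil _))).append hc₁
    -- The child has nothing below its stack word and its input word is empty, so its execution
    -- stops here.
    have hex₂' : M.Exec [(p₂, w₂)] π₂ (c₂ ++ [(p₂', w₂')]) := by
      simpa using hex₂ [] _ (.nil _)
    have fire : ∀ v d, M.Exec [(p₁', w₁' ++ v)] σ d →
        M.Exec [(p, γ :: v)] (a :: π) (c₂ ++ [(p₂', w₂')] ++ c₁ ++ d) := by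
      intro v d h
      refine .cons (by simpa using Network.Step.single [] [] (Network.Fires.spawn v hr)) ?_
      rw [List.append_assoc]
      exact Network.Exec.append h₇ hex₂' (hex₁ v d h)
    generalize c₂ ++ [(p₂', w₂')] ++ c₁ = c at hc fire
    by_cases hq : ∃ s p, A.stepP s p q₁
    · obtain ⟨s₃, p₃, hq⟩ := hq
      obtain ⟨rfl, rfl⟩ := hw₁.eq_of_not_entered fun _ _ => A.stepP_no_other_pred _ _ _ _ _ hq
      obtain ⟨c₃, p₃, w₃, s₃, t₃, hc₃, ht₃, hw₃, hex₃⟩ := ih₃.1 _ _ ht₁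
      refine ⟨c ++ c₃, p₃, w₃, s₃, t₃, hc.append hc₃, ht₃, hw₃, fun v d h => ?_⟩
      rw [List.append_assoc]
      exact fire (x ++ v) _ (hex₃ v d h)
    · push Not at hq
      obtain ⟨rfl, hx⟩ := ih₃.2 hq
      refine ⟨c, p₁', w₁' ++ x, s₁, t₁, hc, ht₁, hw₁.append hx, fun v d h => ?_⟩
      exact fire (x ++ v) _ (by rwa [← List.append_assoc])

theorem Accepts.sound {s c π f} (h : A.Accepts M s c π f) :
    ∃ d, A.ConfRun s d f ∧ M.Exec c π d := by
  induction h with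
  | nil s => exact ⟨[], .nil _, .nil _⟩
  | @cons s t π₁ s' c π₂ s'' π ht _ hs ih =>
    obtain ⟨p, w⟩ := t
    obtain ⟨sp, q, h₁, h₂, h₃⟩ := ht
    obtain ⟨d, hd, hex⟩ := ih
    obtain ⟨c', p', w', s₁, t, hc, ht, hw, hex'⟩ := h₂.sound.1 _ _ h₁
    have hx : M.Exec [(p, w)] π₁ (c' ++ [(p', w')]) := by simpa using hex' [] _ (.nil _)
    exact ⟨_, (hc.append (.cons ht hw h₃ (.nil _))).append hd, Network.Exec.append hs hx hex⟩

/-! #### Completeness -/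

theorem ConfRun.accepts {s c f} (h : A.ConfRun s c f) : A.Accepts M s c [] f := by
  induction h with
  | nil => exact .nil _
  | cons h₁ h₂ h₃ _ ih => exact .cons ⟨_, _, h₁, .of_stackRun h₂ _, h₃⟩ ih .nil

/-- The action is put in front of the word of the firing process only, before shuffling, so that it
may still either stand alone or synchronize. -/
theorem Accepts.of_fires (hA : ∀ s p, ∃ t, A.stepP s p t) {t a d} (h : M.Fires t a d)
    {s c π f} (hd : A.Accepts M s (d ++ c) π f) :
    ∃ π₁ s' π₂, A.AcceptsThread M s t (a :: π₁) s' ∧ A.Accepts M s' c π₂ f ∧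
      Shuffled M.bar π₁ π₂ π := by
  cases h with
  | push x hr =>
    obtain ⟨sp, hsp⟩ := hA s _
    cases hd with
    | cons ht hc hs =>
      obtain ⟨sp', q, h₁, h₂, h₃⟩ := ht
      obtain ⟨q₁, σ, h₄, h₅⟩ := h₂.split rfl
      exact ⟨_, _, _, ⟨sp, q, hsp, .push hr hsp h₁ h₄ h₅, h₃⟩, hc, hs⟩
  | spawn x hr =>
    obtain ⟨sp, hsp⟩ := hA s _
    cases hd with
    | cons ht₂ hd hs₂ =>
      cases hd with
      | cons ht₁ hc hs₁ =>
        obtain ⟨sp₂, q₂, h₁, h₂, h₃⟩ := ht₂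
        obtain ⟨sp₁, q, h₄, h₅, h₆⟩ := ht₁
        obtain ⟨q₁, σ, h₇, h₈⟩ := h₅.split rfl
        obtain ⟨y, hy, hy'⟩ := hs₂.assoc hs₁
        exact ⟨y, _, _, ⟨sp, q, hsp, .spawn hr hsp h₁ h₂ h₃ h₄ h₇ hy h₈, h₆⟩, hc, hy'⟩

/-- The processes on the left stay idle, so the shuffle takes its first letter from the right. -/
theorem Accepts.append_left {c c' : Conf P Γ} {a : Act Lab} {f : SC}
    (h : ∀ {s π}, A.Accepts M s c π f → A.Accepts M s c' (a :: π) f) :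
    ∀ (d : Conf P Γ) {s π}, A.Accepts M s (d ++ c) π f → A.Accepts M s (d ++ c') (a :: π) f
  | [], _, _, hc => h hc
  | _ :: d, _, _, .cons ht hc hs => .cons ht (append_left h d hc) (.right a hs)

theorem Accepts.of_step (hA : ∀ s p, ∃ t, A.stepP s p t) {c a c'} (h : M.Step c a c')
    {s π f} (hc : A.Accepts M s c' π f) : A.Accepts M s c (a :: π) f := by
  cases h with
  | single c₁ c₂ h =>
    rw [List.append_assoc] at hc ⊢
    refine append_left (fun hd => ?_) c₁ hc
    obtain ⟨π₁, s', π₂, h₁, h₂, h₃⟩ := of_fires hA h hd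
    exact .cons h₁ h₂ (.left _ h₃)
  | sync l c₁ c₂ c₃ h h' =>
    simp only [List.append_assoc] at hc ⊢
    refine append_left (fun hd => ?_) c₁ hc
    obtain ⟨π₁, s', π₂, h₁, h₂, h₃⟩ := of_fires hA h hd
    -- The co-action heads the word of everything right of the first partner, where it meets `l` and
    -- becomes `τ`.
    refine .cons h₁ (append_left (a := .sig (M.bar l)) (fun hd' => ?_) c₂ h₂) (.sync l h₃)
    obtain ⟨π₁', s'', π₂', h₄, h₅, h₆⟩ := of_fires hA h' hd'
    exact .cons h₄ h₅ (.left _ h₆)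

theorem Accepts.of_exec (hA : ∀ s p, ∃ t, A.stepP s p t) {c π d} (h : M.Exec c π d)
    {s f} (hd : A.ConfRun s d f) : A.Accepts M s c π f := by
  induction h with
  | nil => exact hd.accepts
  | cons h _ ih => exact of_step hA h (ih hd)

theorem language_labelled_leastLabel (hA : ∀ s p, ∃ t, A.stepP s p t) :
    (A.labelled M (A.leastLabel M)).language M.bar = M.prePi A.language := by
  ext ⟨c, π⟩
  rw [mem_language_labelled_iff]
  constructor
  · rintro ⟨f, hf, h⟩
    obtain ⟨d, hd, hex⟩ := h.sound
    exact ⟨d, ⟨f, hf, hd⟩, Network.exec_iff.1 hex⟩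
  · rintro ⟨d, ⟨f, hf, hd⟩, h⟩
    exact ⟨f, hf, .of_exec hA (Network.exec_iff.2 h) hd⟩

end MAutomaton

end SDPN

theorem mainTheorem1 {Lab P Γ SC SS : Type*} [Finite Lab] [Finite P] [Finite Γ] [Finite SC]
    [Finite SS] (M : SDPN.Network Lab P Γ) (A : SDPN.MAutomaton P Γ SC SS)
    (C : Set (SDPN.Conf P Γ)) (hC : A.language = C) :
    ∃ lam : (SS ⊕ SC × P) → Γ → (SS ⊕ SC × P) → SDPN.PathFun Lab,
      IsLeast {l | A.complete.IsSolution M l} lam ∧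
        (A.complete.labelled M lam).language M.bar = M.prePi C :=
  ⟨A.complete.leastLabel M, A.complete.isLeast_leastLabel M, by
    rw [SDPN.MAutomaton.language_labelled_leastLabel A.exists_complete_stepP,
      A.language_complete, hC]⟩
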